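/- Let $\mathcal V$ be a finite set of sites, each site $x$ carrying a nonzero finite-dimensional Hilbert space $\mathcal H_x$, and let $\mathcal H=\bigotimes_{x\in\mathcal V}\mathcal H_x$. Let $\hat H=\sum_{X\in\mathcal E}\hat H_X$, where $\mathcal E$ is a set of subsets of $\mathcal V$ (the edges) and each $\hat H_X$ is self-adjoint and supported in $X$. For $\beta\in\mathbb R$ put $\langle \hat O\rangle_\beta=\mathrm{Tr}[\hat O e^{-\beta \hat H}]/\mathrm{Tr}\,e^{-\beta \hat H}$ and $\mathrm{Var}_\beta\hat O=\langle \hat O^2\rangle_\beta-\langle \hat O\rangle_\beta^2$. Let $d(x,y)$ be the least $d\ge 0$ for which there are edges $X_1,\dots,X_d$ with $x\in X_1$, $y\in X_d$ and $X_i\cap X_{i+1}\ne\emptyset$ for $1\le i<d$ (with $d(x,x)=0$, and $d(x,y)=\infty$ if there is no such sequence); let $d(x,Y)=\min_{y\in Y}d(x,y)$ and $d(X,Y)=\min_{x\in X}d(x,Y)$ for subsets $X,Y\subset\mathcal V$. Let $X_\partial$ be the set of edges that meet both $X$ and $\mathcal V\setminus X$, and put $N_\partial=\max_{X\in\mathcal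 E}|X_\partial|$, $N=\max_{X\in\mathcal E}|X|$, $J=\max_{X\in\mathcal E}\|\hat H_X\|_\infty$, where $\|\cdot\|_\infty$ is the operator norm. Assume that $N_\partial\ge 1$; that $M>0$ satisfies $|\{Y\in\mathcal E: d(x,Y)=n\}|\le M(n+1)^2$ for all $x\in\mathcal V$ and all integers $n\ge 0$; and that $\beta^*$ and $\xi$ are such that for every $|\beta|<\beta^*$ the number $\xi(\beta)>0$ is a correlation length at $\beta$, that is, for all disjoint $X,Y\subset\mathcal V$ and all self-adjoint operators $\hat O_X,\hat O_Y$ supported in $X$ and $Y$ respectively, $$\left|\langle \hat O_X\hat O_Y\rangle_\beta-\langle \hat O_X\rangle_\beta\langle \hat O_Y\rangle_\beta\right|\le 4(\xi(\beta)+1)\min(|X_\partial|,|Y_\partial|)\,\|\hat O_X\|_\infty\|\hat O_Y\|_\infty\, e^{-d(X,Y)/\xi(\beta)}$$ (with $e^{-\infty}=0$). Then for every $\mathcal G\subset\mathcal E$ and every $|\beta|<\beta^*$, the operator $\hat H_{\mathcal G}=\sum_{X\in\mathcal G}\hat H_X$ satisfies $$\mathrm{Var}_\beta\,\hat H_{\mathcal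 G}\le 8\,N_\partial\,J^2\,|\mathcal G|\,N\,M\,(\xi(\beta)+1)^4 .$$ In particular, the variance grows at most linearly with $|\mathcal G|$. -/

import Mathlib

open scoped NNReal ENat

noncomputable section

namespace LocalLattice

variable {V : Type*} [Fintype V] [DecidableEq V]

/-! ### Geometry of the lattice: a finite set `V` of sites, a finite set `E` of edges -/

/-- `l = [X₁, …, X_d]` is a sequence of edges from `x` to `y`: `x ∈ X₁`, `y ∈ X_d`, and consecutive
edges overlap. The empty sequence joins a site only to itself, so that `d(x, x) = 0`. -/
def IsEdgePath (E : Finset (Finset V)) (x y : V) (l : List (Finset V)) : Prop :=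
  (∀ X ∈ l, X ∈ E) ∧ (∀ X ∈ l.head?, x ∈ X) ∧ (∀ X ∈ l.getLast?, y ∈ X) ∧
    l.IsChain (fun X Y => (X ∩ Y).Nonempty) ∧ (l = [] → x = y)

/-- `d(x, y)`: the length of a shortest sequence of edges from `x` to `y` (`⊤` if there is none). -/
def siteDist (E : Finset (Finset V)) (x y : V) : ℕ∞ :=
  ⨅ l : {l : List (Finset V) // IsEdgePath E x y l}, (l.1.length : ℕ∞)

/-- `d(x, Y) = min_{y ∈ Y} d(x, y)`. -/
def siteSetDist (E : Finset (Finset V)) (x : V) (Y : Finset V) : ℕ∞ :=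
  ⨅ y ∈ Y, siteDist E x y

/-- `d(X, Y) = min_{x ∈ X} d(x, Y)`. -/
def setDist (E : Finset (Finset V)) (X Y : Finset V) : ℕ∞ :=
  ⨅ x ∈ X, siteSetDist E x Y

/-- The boundary edge set `X_∂`: the edges that meet both `X` and its complement. -/
def boundary (E : Finset (Finset V)) (X : Finset V) : Finset (Finset V) :=
  E.filter (fun Y => (Y ∩ X).Nonempty ∧ (Y ∩ Xᶜ).Nonempty)

/-- `N_∂ = max_{X ∈ E} |X_∂|`. -/
def maxBoundary (E : Finset (Finset V)) : ℕ :=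
  E.sup (fun X => (boundary E X).card)

/-- `N = max_{X ∈ E} |X|`. -/
def maxEdgeSize (E : Finset (Finset V)) : ℕ :=
  E.sup Finset.card

open Classical in
/-- The number of edges at distance `n` from any site is at most `M (n + 1)²`. -/
def QuadraticGrowth (E : Finset (Finset V)) (M : ℝ) : Prop :=
  ∀ (x : V) (n : ℕ),
    ((E.filter (fun Y => siteSetDist E x Y = (n : ℕ∞))).card : ℝ) ≤ M * ((n : ℝ) + 1) ^ 2

/-- `e^{-d/ξ}`, with the value `0` at `d = ∞`. -/
def expDecay (ξ : ℝ) (d : ℕ∞) : ℝ :=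
  if d = ⊤ then 0 else Real.exp (-(d.toNat : ℝ) / ξ)

/-! ### Operators

The Hilbert space of the site `x` is `ℂ^{ι x}`, the one of the system is
`⨂ₓ ℂ^{ι x} = ℂ^{∏ₓ ι x}`. Operators are written as matrices in the product basis. -/

/-- Operators on the global Hilbert space. -/
abbrev Op (ι : V → Type*) : Type _ := Matrix (∀ x, ι x) (∀ x, ι x) ℂ

variable {ι : V → Type*} [∀ x, Fintype (ι x)] [∀ x, DecidableEq (ι x)]

/-- `O` is supported in `X`: it is of the form `A ⊗ 𝟙` with `A` an operator on
`⨂_{x ∈ X} ℂ^{ι x}` and `𝟙` the identity of the remaining sites. -/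
def SupportedIn (X : Finset V) (O : Op ι) : Prop :=
  ∃ A : Matrix (∀ x : X, ι x) (∀ x : X, ι x) ℂ, ∀ i j : (∀ x, ι x),
    O i j = if ∀ x, x ∉ X → i x = j x then A (fun x => i x) (fun x => j x) else 0

/-- The operator norm `‖O‖_∞` on the Hilbert space. -/
def opNorm (O : Op ι) : ℝ≥0 := ‖Matrix.toEuclideanCLM (𝕜 := ℂ) O‖₊

/-- A local Hamiltonian: a finite set of edges and, for each edge `X`, a self-adjoint interaction
term `H_X` supported in `X`. (The values of `term` outside `edges` play no role.) -/
structure LocalHamiltonian (ι : V → Type*) [∀ x, DecidableEq (ι x)] where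
  /-- The set of edges. -/
  edges : Finset (Finset V)
  /-- The interaction terms `H_X`. -/
  term : Finset V → Op ι
  isHermitian : ∀ X ∈ edges, (term X).IsHermitian
  supportedIn : ∀ X ∈ edges, SupportedIn X (term X)

namespace LocalHamiltonian

variable (S : LocalHamiltonian ι)

/-- `H_G = ∑_{X ∈ G} H_X`. -/
def sumTerms (G : Finset (Finset V)) : Op ι := ∑ X ∈ G, S.term X

/-- The interaction strength `J = max_{X ∈ E} ‖H_X‖_∞`. -/
def strength : ℝ≥0 := S.edges.sup (fun X => opNorm (S.term X))

/-- The Gibbs state `e^{-βH} / Tr e^{-βH}` of the total Hamiltonian `H = ∑_{X ∈ E} H_X`. -/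
def gibbs (β : ℝ) : Op ι :=
  (Matrix.trace (NormedSpace.exp (-(β : ℂ) • S.sumTerms S.edges)))⁻¹ •
    NormedSpace.exp (-(β : ℂ) • S.sumTerms S.edges)

/-- The Gibbs expectation value `⟨O⟩_β = Tr[O ω(β)]`. -/
def expect (β : ℝ) (O : Op ι) : ℂ := Matrix.trace (O * S.gibbs β)

/-- `⟨O P⟩_β - ⟨O⟩_β ⟨P⟩_β`. -/
def cov (β : ℝ) (O P : Op ι) : ℂ :=
  S.expect β (O * P) - S.expect β O * S.expect β P

/-- The variance `⟨O²⟩_β - ⟨O⟩_β²` of an observable (a real number for self-adjoint `O`). -/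
def variance (β : ℝ) (O : Op ι) : ℝ := (S.cov β O O).re

/-- Exponential clustering of correlations at inverse temperature `β` with correlation length `ξ`,
for observables with disjoint supports. -/
def Clustering (β ξ : ℝ) : Prop :=
  ∀ (X Y : Finset V) (O P : Op ι), Disjoint X Y →
    O.IsHermitian → P.IsHermitian → SupportedIn X O → SupportedIn Y P →
    ‖S.cov β O P‖ ≤
      4 * (ξ + 1) * (min (boundary S.edges X).card (boundary S.edges Y).card : ℕ) *
        opNorm O * opNorm P * expDecay ξ (setDist S.edges X Y)

/-- `ξ(β)` is a correlation length of the system for every `|β| < β*`. -/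
def IsCorrelationLength (βstar : ℝ) (ξ : ℝ → ℝ) : Prop :=
  ∀ β : ℝ, |β| < βstar → 0 < ξ β ∧ S.Clustering β (ξ β)

end LocalHamiltonian

end LocalLattice

end

namespace LocalLattice

open Finset

/-! ### Distances and boundaries of edges. -/

section Geometry

/-! The variance is a double sum of covariances of interaction terms. Each is at most `C * exp
(-d(X,Y)/ξ)` with `C = 4(ξ+1) N_∂ J²`: clustering gives this for disjoint edges, and overlapping
edges have `d = 0`, where the trivial bound `2J²` suffices because `N_∂ ≥ 1` (`norm_cov_term_le`).
For fixed `X`, the decay is summable over all edges: a union bound over the sites of `X` costs `N`,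
and around one site the shells of at most `M(n+1)²` edges contribute at most `2M(ξ+1)³`
(`sum_expDecay_setDist_le`). Hence each `X ∈ G` costs a constant, and `4 · 2 = 8`. -/

lemma card_le_maxEdgeSize {V : Type*} {E : Finset (Finset V)} {X : Finset V} (hX : X ∈ E) :
    X.card ≤ maxEdgeSize E :=
  Finset.le_sup (f := Finset.card) hX

variable {V : Type*} [DecidableEq V]

lemma siteDist_self (E : Finset (Finset V)) (x : V) : siteDist E x x = 0 := by
  have h : IsEdgePath E x x [] := by simp [IsEdgePath]
  exact le_antisymm ((iInf_le _ ⟨[], h⟩).trans (by simp)) bot_le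

lemma setDist_eq_zero_of_not_disjoint (E : Finset (Finset V)) {X Y : Finset V}
    (h : ¬ Disjoint X Y) : setDist E X Y = 0 := by
  obtain ⟨x, hX, hY⟩ := Finset.not_disjoint_iff.1 h
  refine le_antisymm ?_ bot_le
  calc setDist E X Y ≤ siteSetDist E x Y := iInf₂_le x hX
    _ ≤ siteDist E x x := iInf₂_le x hY
    _ = 0 := siteDist_self E x

lemma exists_setDist_eq (E : Finset (Finset V)) {X : Finset V} (hX : X.Nonempty) (Y : Finset V) :
    ∃ x ∈ X, setDist E X Y = siteSetDist E x Y := by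
  obtain ⟨x, hx, h⟩ := X.exists_mem_eq_inf hX (fun x => siteSetDist E x Y)
  exact ⟨x, hx, by rw [← h, Finset.inf_eq_iInf]; rfl⟩

lemma setDist_empty (E : Finset (Finset V)) (Y : Finset V) : setDist E ∅ Y = ⊤ := by
  simp [setDist]

lemma card_boundary_le_maxBoundary [Fintype V] {E : Finset (Finset V)} {X : Finset V} (hX : X ∈ E) :
    (boundary E X).card ≤ maxBoundary E :=
  Finset.le_sup (f := fun X => (boundary E X).card) hX

end Geometry

/-! ### Summability of the exponential decay. -/

section Decay

lemma expDecay_nonneg (ξ : ℝ) (d : ℕ∞) : 0 ≤ expDecay ξ d := by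
  unfold expDecay
  split_ifs <;> positivity

lemma expDecay_zero (ξ : ℝ) : expDecay ξ 0 = 1 := by
  simp [expDecay]

lemma expDecay_coe (ξ : ℝ) (n : ℕ) : expDecay ξ n = Real.exp (-1 / ξ) ^ n := by
  rw [expDecay, if_neg (ENat.natCast_ne_top n), ← Real.exp_nat_mul]
  congr 1
  simp only [ENat.toNat_natCast]
  ring

lemma exp_neg_one_div_lt_one {ξ : ℝ} (hξ : 0 < ξ) : Real.exp (-1 / ξ) < 1 := by
  rw [Real.exp_lt_one_iff]
  exact div_neg_of_neg_of_pos (by norm_num) hξ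

/-- Equivalent to `exp (1/ξ) ≥ 1 + 1/ξ`. -/
lemma inv_one_sub_exp_le {ξ : ℝ} (hξ : 0 < ξ) : 1 / (1 - Real.exp (-1 / ξ)) ≤ ξ + 1 := by
  have h1 : 1 / ξ + 1 ≤ Real.exp (1 / ξ) := Real.add_one_le_exp _
  have h2 : Real.exp (-1 / ξ) ≤ ξ / (ξ + 1) := by
    rw [neg_div, Real.exp_neg, ← one_div, div_le_div_iff₀ (Real.exp_pos _) (by positivity)]
    calc 1 * (ξ + 1) = ξ * (1 / ξ + 1) := by field_simp; ring
      _ ≤ ξ * Real.exp (1 / ξ) := by gcongr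
  have h3 : 1 / (ξ + 1) ≤ 1 - Real.exp (-1 / ξ) := by
    have : ξ / (ξ + 1) = 1 - 1 / (ξ + 1) := by field_simp; ring
    linarith
  calc 1 / (1 - Real.exp (-1 / ξ)) ≤ 1 / (1 / (ξ + 1)) :=
        one_div_le_one_div_of_le (by positivity) h3
    _ = ξ + 1 := one_div_one_div _

/-- Compare `(n+1)² ≤ (n+1)(n+2) = 2 * choose (n+2) 2`, whose generating function is `2/(1-q)³`. -/
lemma sum_sq_mul_geometric_le {ξ : ℝ} (hξ : 0 < ξ) (K : ℕ) :
    ∑ n ∈ range K, ((n : ℝ) + 1) ^ 2 * Real.exp (-1 / ξ) ^ n ≤ 2 * (ξ + 1) ^ 3 := by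
  set q := Real.exp (-1 / ξ) with hq
  have hq0 : 0 < q := Real.exp_pos _
  have hq1 : q < 1 := exp_neg_one_div_lt_one hξ
  have hs := hasSum_choose_mul_geometric_of_norm_lt_one (𝕜 := ℝ) 2
    (r := q) (by rwa [Real.norm_of_nonneg hq0.le])
  calc ∑ n ∈ range K, ((n : ℝ) + 1) ^ 2 * q ^ n
      ≤ ∑ n ∈ range K, 2 * (((n + 2).choose 2 : ℕ) * q ^ n) := by
        refine Finset.sum_le_sum fun n _ => ?_
        rw [← mul_assoc]
        gcongr
        rw [Nat.cast_choose_two]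
        push_cast
        nlinarith [Nat.cast_nonneg (α := ℝ) n]
    _ = 2 * ∑ n ∈ range K, (((n + 2).choose 2 : ℕ) * q ^ n) := by rw [Finset.mul_sum]
    _ ≤ 2 * (1 / (1 - q) ^ (2 + 1)) := by
        gcongr
        exact sum_le_hasSum _ (fun n _ => by positivity) hs
    _ = 2 * (1 / (1 - q)) ^ 3 := by rw [one_div_pow]
    _ ≤ 2 * (ξ + 1) ^ 3 := by
        have : 0 ≤ 1 / (1 - q) := one_div_nonneg.2 (by linarith)
        gcongr
        exact inv_one_sub_exp_le hξ

variable {V : Type*} [DecidableEq V]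

lemma sum_expDecay_siteSetDist_le {E : Finset (Finset V)} {M ξ : ℝ} (hM : 0 ≤ M) (hξ : 0 < ξ)
    (hE : QuadraticGrowth E M) (x : V) :
    ∑ Y ∈ E, expDecay ξ (siteSetDist E x Y) ≤ M * (2 * (ξ + 1) ^ 3) := by
  classical
  set q := Real.exp (-1 / ξ) with hq
  have hq0 : 0 < q := Real.exp_pos _
  -- `K` exceeds every finite distance, so finitely many shells contain all reachable edges; edges
  -- at distance `⊤` contribute zero.
  set K := E.sup (fun Y => (siteSetDist E x Y).toNat) + 1 with hK
  calc ∑ Y ∈ E, expDecay ξ (siteSetDist E x Y)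
      ≤ ∑ Y ∈ E, ∑ n ∈ range K, if siteSetDist E x Y = (n : ℕ∞) then q ^ n else 0 := by
        refine Finset.sum_le_sum fun Y hY => ?_
        have hnn : ∀ n ∈ range K,
            0 ≤ if siteSetDist E x Y = (n : ℕ∞) then q ^ n else 0 := fun n _ => by
          split_ifs <;> positivity
        by_cases hd : siteSetDist E x Y = ⊤
        · rw [expDecay, if_pos hd]
          exact Finset.sum_nonneg hnn
        · have hm : (siteSetDist E x Y).toNat ∈ range K :=
            Finset.mem_range.2 (Nat.lt_succ_of_le
              (Finset.le_sup (f := fun Y => (siteSetDist E x Y).toNat) hY))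
          have hc : siteSetDist E x Y = ((siteSetDist E x Y).toNat : ℕ∞) :=
            (ENat.natCast_toNat hd).symm
          refine le_trans (le_of_eq ?_) (Finset.single_le_sum hnn hm)
          rw [if_pos hc, hq, ← expDecay_coe, ← hc]
    _ = ∑ n ∈ range K, ((E.filter (fun Y => siteSetDist E x Y = (n : ℕ∞))).card : ℝ) * q ^ n := by
        rw [Finset.sum_comm]
        refine Finset.sum_congr rfl fun n _ => ?_
        rw [← Finset.sum_filter, Finset.sum_const, nsmul_eq_mul]
    _ ≤ ∑ n ∈ range K, M * (((n : ℝ) + 1) ^ 2 * q ^ n) := by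
        refine Finset.sum_le_sum fun n _ => ?_
        rw [← mul_assoc]
        gcongr
        convert hE x n
    _ = M * ∑ n ∈ range K, ((n : ℝ) + 1) ^ 2 * q ^ n := by rw [Finset.mul_sum]
    _ ≤ M * (2 * (ξ + 1) ^ 3) := by
        gcongr
        exact sum_sq_mul_geometric_le hξ K

/-- The minimum over `X` is attained, so the left side is one of the nonnegative summands. -/
lemma expDecay_setDist_le_sum (E : Finset (Finset V)) (ξ : ℝ) (X Y : Finset V) :
    expDecay ξ (setDist E X Y) ≤ ∑ x ∈ X, expDecay ξ (siteSetDist E x Y) := by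
  rcases X.eq_empty_or_nonempty with rfl | hX
  · simp [setDist_empty, expDecay]
  · obtain ⟨x, hx, h⟩ := exists_setDist_eq E hX Y
    rw [h]
    exact Finset.single_le_sum (f := fun x => expDecay ξ (siteSetDist E x Y))
      (fun _ _ => expDecay_nonneg _ _) hx

lemma sum_expDecay_setDist_le {E : Finset (Finset V)} {M ξ : ℝ} (hM : 0 ≤ M) (hξ : 0 < ξ)
    (hE : QuadraticGrowth E M) (X : Finset V) :
    ∑ Y ∈ E, expDecay ξ (setDist E X Y) ≤ X.card * (M * (2 * (ξ + 1) ^ 3)) := by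
  calc ∑ Y ∈ E, expDecay ξ (setDist E X Y)
      ≤ ∑ Y ∈ E, ∑ x ∈ X, expDecay ξ (siteSetDist E x Y) :=
        Finset.sum_le_sum fun Y _ => expDecay_setDist_le_sum E ξ X Y
    _ = ∑ x ∈ X, ∑ Y ∈ E, expDecay ξ (siteSetDist E x Y) := Finset.sum_comm
    _ ≤ ∑ _x ∈ X, M * (2 * (ξ + 1) ^ 3) :=
        Finset.sum_le_sum fun x _ => sum_expDecay_siteSetDist_le hM hξ hE x
    _ = X.card * (M * (2 * (ξ + 1) ^ 3)) := by rw [Finset.sum_const, nsmul_eq_mul]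

end Decay

/-! ### Traces against positive matrices. -/

section Trace

open Matrix

variable {n : Type*} [Fintype n] [DecidableEq n]

lemma trace_mul_mul_conjTranspose_eq_sum_inner (O B : Matrix n n ℂ) :
    trace (O * (B * Bᴴ)) = ∑ i, inner ℂ (WithLp.toLp 2 (B.col i))
      (toEuclideanCLM (𝕜 := ℂ) O (WithLp.toLp 2 (B.col i))) := by
  rw [← Matrix.mul_assoc, trace_mul_comm, trace]
  refine Finset.sum_congr rfl fun i _ => ?_
  rw [toEuclideanCLM_toLp, EuclideanSpace.inner_toLp_toLp, dotProduct_comm]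
  rfl

lemma trace_mul_conjTranspose_eq_sum_norm (B : Matrix n n ℂ) :
    trace (B * Bᴴ) = ((∑ i, ‖WithLp.toLp 2 (B.col i)‖ ^ 2 : ℝ) : ℂ) := by
  have h := trace_mul_mul_conjTranspose_eq_sum_inner 1 B
  rw [Matrix.one_mul] at h
  rw [h]
  push_cast
  refine Finset.sum_congr rfl fun i _ => ?_
  rw [toEuclideanCLM_toLp, one_mulVec, inner_self_eq_norm_sq_to_K]
  rfl

/-- Both traces are sums over the columns `b` of `B`, of `⟨b, O b⟩` and of `‖b‖²`; Cauchy–Schwarz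
compares them termwise. -/
lemma norm_trace_mul_mul_conjTranspose_le (O B : Matrix n n ℂ) :
    ‖trace (O * (B * Bᴴ))‖ ≤ ‖toEuclideanCLM (𝕜 := ℂ) O‖ * ‖trace (B * Bᴴ)‖ := by
  rw [trace_mul_conjTranspose_eq_sum_norm, Complex.norm_real,
    Real.norm_of_nonneg (by positivity), trace_mul_mul_conjTranspose_eq_sum_inner, Finset.mul_sum]
  refine (norm_sum_le _ _).trans (Finset.sum_le_sum fun i _ => ?_)
  set v := WithLp.toLp 2 (B.col i)
  calc ‖inner ℂ v (toEuclideanCLM (𝕜 := ℂ) O v)‖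
      ≤ ‖v‖ * ‖toEuclideanCLM (𝕜 := ℂ) O v‖ := norm_inner_le_norm _ _
    _ ≤ ‖v‖ * (‖toEuclideanCLM (𝕜 := ℂ) O‖ * ‖v‖) := by
        gcongr
        exact ContinuousLinearMap.le_opNorm _ _
    _ = ‖toEuclideanCLM (𝕜 := ℂ) O‖ * ‖v‖ ^ 2 := by ring

/-- Take `B = exp (A/2)`, itself Hermitian. -/
lemma exists_exp_eq_mul_conjTranspose {A : Matrix n n ℂ} (hA : A.IsHermitian) :
    ∃ B : Matrix n n ℂ, NormedSpace.exp A = B * Bᴴ := by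
  have hhalf : ((2 : ℝ)⁻¹ • A).IsHermitian := by
    rw [Matrix.IsHermitian, conjTranspose_smul, hA.eq, star_trivial]
  refine ⟨NormedSpace.exp ((2 : ℝ)⁻¹ • A), ?_⟩
  rw [hhalf.exp.eq, ← Matrix.exp_add_of_commute _ _ (Commute.refl _), ← add_smul]
  norm_num

end Trace

/-! ### Gibbs expectations and covariances. -/

namespace LocalHamiltonian

variable {V : Type*} [Fintype V] [DecidableEq V]
  {ι : V → Type*} [∀ x, DecidableEq (ι x)]

lemma isHermitian_sumTerms (S : LocalHamiltonian ι) {G : Finset (Finset V)} (hG : G ⊆ S.edges) :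
    (S.sumTerms G).IsHermitian := by
  rw [Matrix.IsHermitian, sumTerms, Matrix.conjTranspose_sum]
  exact Finset.sum_congr rfl fun X hX => S.isHermitian X (hG hX)

variable [∀ x, Fintype (ι x)]

lemma opNorm_mul_le (O P : Op ι) : opNorm (O * P) ≤ opNorm O * opNorm P := by
  unfold opNorm
  rw [map_mul]
  exact nnnorm_mul_le _ _

variable (S : LocalHamiltonian ι)

lemma norm_expect_le (β : ℝ) (O : Op ι) : ‖S.expect β O‖ ≤ opNorm O := by
  have hH : (-(β : ℂ) • S.sumTerms S.edges).IsHermitian := by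
    rw [Matrix.IsHermitian, Matrix.conjTranspose_smul, (S.isHermitian_sumTerms subset_rfl).eq]
    simp
  obtain ⟨B, hB⟩ := exists_exp_eq_mul_conjTranspose hH
  rw [expect, gibbs, hB, Matrix.mul_smul, Matrix.trace_smul, norm_smul, norm_inv, inv_mul_eq_div]
  -- This form of the division bound allows a zero denominator, so positivity of the partition
  -- function need not be shown.
  exact div_le_of_le_mul₀ (norm_nonneg _) (opNorm O).coe_nonneg
    (norm_trace_mul_mul_conjTranspose_le O B)

lemma expect_sum (β : ℝ) {α : Type*} (s : Finset α) (f : α → Op ι) :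
    S.expect β (∑ a ∈ s, f a) = ∑ a ∈ s, S.expect β (f a) := by
  simp only [expect, Finset.sum_mul, Matrix.trace_sum]

lemma cov_sumTerms (β : ℝ) (G : Finset (Finset V)) :
    S.cov β (S.sumTerms G) (S.sumTerms G) =
      ∑ X ∈ G, ∑ Y ∈ G, S.cov β (S.term X) (S.term Y) := by
  simp only [cov, sumTerms, Finset.sum_mul_sum, expect_sum, Finset.sum_sub_distrib]

lemma norm_cov_le (β : ℝ) (O P : Op ι) : ‖S.cov β O P‖ ≤ 2 * (opNorm O * opNorm P) := by
  have h1 : ‖S.expect β (O * P)‖ ≤ opNorm O * opNorm P :=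
    (S.norm_expect_le β _).trans (mod_cast opNorm_mul_le O P)
  have h2 : ‖S.expect β O * S.expect β P‖ ≤ opNorm O * opNorm P := by
    rw [norm_mul]
    gcongr <;> exact S.norm_expect_le β _
  calc ‖S.cov β O P‖ ≤ ‖S.expect β (O * P)‖ + ‖S.expect β O * S.expect β P‖ := norm_sub_le _ _
    _ ≤ 2 * (opNorm O * opNorm P) := by linarith

lemma opNorm_term_le_strength {X : Finset V} (hX : X ∈ S.edges) :
    (opNorm (S.term X) : ℝ) ≤ S.strength :=
  NNReal.coe_le_coe.2 (Finset.le_sup (f := fun X => opNorm (S.term X)) hX)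

/-- Clustering extends to overlapping edges, at distance zero, by the trivial bound. -/
lemma norm_cov_term_le (hNb : 0 < maxBoundary S.edges) {β ξ : ℝ} (hξ : 0 < ξ)
    (hS : S.Clustering β ξ) {X Y : Finset V} (hX : X ∈ S.edges) (hY : Y ∈ S.edges) :
    ‖S.cov β (S.term X) (S.term Y)‖ ≤
      4 * (ξ + 1) * maxBoundary S.edges * (S.strength : ℝ) ^ 2 *
        expDecay ξ (setDist S.edges X Y) := by
  have hJX := S.opNorm_term_le_strength hX
  have hJY := S.opNorm_term_le_strength hY
  have hN : (1 : ℝ) ≤ maxBoundary S.edges := mod_cast hNb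
  have hnn := expDecay_nonneg ξ (setDist S.edges X Y)
  by_cases hd : Disjoint X Y
  · refine (hS X Y _ _ hd (S.isHermitian X hX) (S.isHermitian Y hY) (S.supportedIn X hX)
      (S.supportedIn Y hY)).trans ?_
    have hb : ((min (boundary S.edges X).card (boundary S.edges Y).card : ℕ) : ℝ) ≤
        maxBoundary S.edges := by
      exact_mod_cast (min_le_left _ _).trans (card_boundary_le_maxBoundary hX)
    rw [sq, ← mul_assoc (4 * (ξ + 1) * _)]
    gcongr
  · rw [setDist_eq_zero_of_not_disjoint _ hd, expDecay_zero, mul_one]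
    -- The clustering prefactor dominates the trivial constant `2`, by `N_∂ ≥ 1` and `ξ > 0`.
    have h4 : 2 ≤ 4 * (ξ + 1) * (maxBoundary S.edges : ℝ) := by nlinarith
    calc ‖S.cov β (S.term X) (S.term Y)‖
        ≤ 2 * (opNorm (S.term X) * opNorm (S.term Y)) := S.norm_cov_le β _ _
      _ ≤ 2 * (S.strength * S.strength : ℝ) := by gcongr
      _ ≤ 4 * (ξ + 1) * maxBoundary S.edges * (S.strength : ℝ) ^ 2 := by
          rw [← sq]
          gcongr

end LocalHamiltonian

end LocalLattice

theorem theorem2 {V : Type*} [Fintype V] [DecidableEq V]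
    {ι : V → Type*} [∀ x, Fintype (ι x)] [∀ x, DecidableEq (ι x)] [∀ x, Nonempty (ι x)]
    (S : LocalLattice.LocalHamiltonian ι)
    (hNb : 0 < LocalLattice.maxBoundary S.edges)
    (M : ℝ) (hM : 0 < M) (hgrowth : LocalLattice.QuadraticGrowth S.edges M)
    (βstar : ℝ) (ξ : ℝ → ℝ) (hξ : S.IsCorrelationLength βstar ξ)
    (G : Finset (Finset V)) (hG : G ⊆ S.edges)
    (β : ℝ) (hβ : |β| < βstar) :
    S.variance β (S.sumTerms G) ≤
      8 * (LocalLattice.maxBoundary S.edges : ℝ) * (S.strength : ℝ) ^ 2 * (G.card : ℝ) *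
        (LocalLattice.maxEdgeSize S.edges : ℝ) * M * (ξ β + 1) ^ 4 := by
  obtain ⟨hpos, hS⟩ := hξ β hβ
  set C : ℝ := 4 * (ξ β + 1) * LocalLattice.maxBoundary S.edges * (S.strength : ℝ) ^ 2 with hC
  have hC0 : 0 ≤ C := by positivity
  calc S.variance β (S.sumTerms G)
      ≤ ‖S.cov β (S.sumTerms G) (S.sumTerms G)‖ := Complex.re_le_norm _
    _ ≤ ∑ X ∈ G, ∑ Y ∈ G, ‖S.cov β (S.term X) (S.term Y)‖ := by
        rw [S.cov_sumTerms]
        exact (norm_sum_le _ _).trans (Finset.sum_le_sum fun X _ => norm_sum_le _ _)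
    _ ≤ ∑ X ∈ G, ∑ Y ∈ G, C * LocalLattice.expDecay (ξ β) (LocalLattice.setDist S.edges X Y) :=
        Finset.sum_le_sum fun X hX => Finset.sum_le_sum fun Y hY =>
          S.norm_cov_term_le hNb hpos hS (hG hX) (hG hY)
    _ ≤ ∑ _X ∈ G, C * (LocalLattice.maxEdgeSize S.edges * (M * (2 * (ξ β + 1) ^ 3))) := by
        refine Finset.sum_le_sum fun X hX => ?_
        rw [← Finset.mul_sum]
        gcongr
        -- Enlarging `G` to all edges only adds nonnegative terms and makes the growth bound
        -- applicable.
        calc ∑ Y ∈ G, LocalLattice.expDecay (ξ β) (LocalLattice.setDist S.edges X Y)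
            ≤ ∑ Y ∈ S.edges, LocalLattice.expDecay (ξ β) (LocalLattice.setDist S.edges X Y) :=
              Finset.sum_le_sum_of_subset_of_nonneg hG
                fun _ _ _ => LocalLattice.expDecay_nonneg _ _
          _ ≤ X.card * (M * (2 * (ξ β + 1) ^ 3)) :=
              LocalLattice.sum_expDecay_setDist_le hM.le hpos hgrowth X
          _ ≤ LocalLattice.maxEdgeSize S.edges * (M * (2 * (ξ β + 1) ^ 3)) := by
              gcongr
              exact LocalLattice.card_le_maxEdgeSize (hG hX)
    _ = 8 * (LocalLattice.maxBoundary S.edges : ℝ) * (S.strength : ℝ) ^ 2 * (G.card : ℝ) *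
        (LocalLattice.maxEdgeSize S.edges : ℝ) * M * (ξ β + 1) ^ 4 := by
        rw [Finset.sum_const, nsmul_eq_mul, hC]
        ring
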